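/- Let $n\ge 1$ and $k\ge 0$ be integers and let $1\le p\le\infty$ (with $1/\infty:=0$). Let $A$ be a regular real $n\times n$ matrix, $\mathbf b\in\mathbb R^n$, and $\varphi(\mathbf x):=A\mathbf x+\mathbf b$. Let $\widehat\Omega\subset\mathbb R^n$ be open (for example a domain) and $\Omega:=\varphi(\widehat\Omega)$. Let $\|A\|$ denote the matrix norm associated with the Euclidean norm. For $v\in W^{k,p}(\Omega)$ (where $W^{0,p}=L^p$) define $$|v|_{k,p,\Omega}:=\Bigl(\sum_{i_1,\dots,i_k=1}^n\int_\Omega\Bigl|\frac{\partial^k v}{\partial x_{i_1}\cdots\partial x_{i_k}}\Bigr|^p\,d\mathbf x\Bigr)^{1/p}\quad(p<\infty),\qquad |v|_{k,\infty,\Omega}:=\max_{i_1,\dots,i_k}\operatorname*{ess\,sup}_{\Omega}\Bigl|\frac{\partial^k v}{\partial x_{i_1}\cdots\partial x_{i_k}}\Bigr|,$$ with derivatives in the sense of distributions; thus the sum has $n^k$ terms, i.e. each multi-index $\delta$ with $|\delta|=k$ is counted $k!/\delta!$ times. Then, for every real-valued $v\in W^{k,p}(\Omega)$, the function $\hat v:=v\circ\varphi$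 belongs to $W^{k,p}(\widehat\Omega)$ and $$n^{-k\mu(p)}\,|\det A|^{1/p}\,\|A\|^{-k}\,|\hat v|_{k,p,\widehat\Omega}\;\le\;|v|_{k,p,\Omega}\;\le\; n^{k\mu(p)}\,|\det A|^{1/p}\,\|A^{-1}\|^{k}\,|\hat v|_{k,p,\widehat\Omega},$$ where $$\mu(p):=\begin{cases}\frac1p-\frac12,&1\le p\le 2,\\[2pt] \frac12-\frac1p,&2\le p\le\infty.\end{cases}$$ Moreover, for $p<\infty$, $\mu(p)=\dfrac{\tau(p)+\gamma(p)}{p}$, where $\tau(p):=1-\frac p2$, $\gamma(p):=0$ for $1\le p\le 2$ and $\tau(p):=0$, $\gamma(p):=\frac p2-1$ for $2\le p<\infty$. -/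

import Mathlib

open MeasureTheory
open scoped ENNReal ContDiff

/-- Euclidean space `ℝⁿ`. -/
abbrev EucSpace (n : ℕ) : Type := EuclideanSpace ℝ (Fin n)

/-- The classical partial derivative `∂_{α 0} ⋯ ∂_{α (m-1)} f` of order `m` of a smooth function,
where `α` lists the `m` coordinate directions. -/
noncomputable def partialDeriv {n m : ℕ} (α : Fin m → Fin n) (f : EucSpace n → ℝ) :
    EucSpace n → ℝ :=
  fun x => iteratedFDeriv ℝ m f x (fun i => EuclideanSpace.single (α i) (1 : ℝ))

/-- `f` is a test function on `Ω`: smooth, with compact support contained in `Ω`. -/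
def IsTestFunction {n : ℕ} (Ω : Set (EucSpace n)) (f : EucSpace n → ℝ) : Prop :=
  ContDiff ℝ ∞ f ∧ HasCompactSupport f ∧ tsupport f ⊆ Ω

/-- `g` is the weak (distributional) derivative `∂_{α 0} ⋯ ∂_{α (m-1)} v` on `Ω`. -/
def HasWeakDeriv {n m : ℕ} (Ω : Set (EucSpace n)) (α : Fin m → Fin n)
    (v g : EucSpace n → ℝ) : Prop :=
  LocallyIntegrableOn v Ω ∧ LocallyIntegrableOn g Ω ∧
    ∀ f : EucSpace n → ℝ, IsTestFunction Ω f →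
      ∫ x in Ω, v x * partialDeriv α f x = (-1) ^ m * ∫ x in Ω, g x * f x

/-- Membership in the Sobolev space `W^{k,p}(Ω)`. (For `m = 0` the weak derivative is `v` itself,
so that `v ∈ L^p(Ω)`.) -/
def MemSobolev {n : ℕ} (k : ℕ) (p : ℝ≥0∞) (Ω : Set (EucSpace n)) (v : EucSpace n → ℝ) : Prop :=
  MemLp v p (volume.restrict Ω) ∧
    ∀ m : ℕ, m ≤ k → ∀ α : Fin m → Fin n,
      ∃ g : EucSpace n → ℝ, HasWeakDeriv Ω α v g ∧ MemLp g p (volume.restrict Ω)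

open Classical in
/-- The weak derivative (unique almost everywhere on an open `Ω`) if it exists, and `0` if not. -/
noncomputable def weakDeriv {n m : ℕ} (Ω : Set (EucSpace n)) (α : Fin m → Fin n)
    (v : EucSpace n → ℝ) : EucSpace n → ℝ :=
  if h : ∃ g : EucSpace n → ℝ, HasWeakDeriv Ω α v g then h.choose else 0

open Classical in
/-- The Sobolev seminorm `|v|_{k,p,Ω}`. The sum runs over the `n ^ k` ordered derivatives
`∂_{α 0} ⋯ ∂_{α (k-1)}` of order `k`, i.e. over the entries of `∇ ⊗ ⋯ ⊗ ∇ v`: a multi-index `δ`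
with `|δ| = k` is counted `k! / δ!` times. -/
noncomputable def sobolevSeminorm {n : ℕ} (k : ℕ) (p : ℝ≥0∞) (Ω : Set (EucSpace n))
    (v : EucSpace n → ℝ) : ℝ :=
  if p = ⊤ then
    ⨆ α : Fin k → Fin n, (eLpNorm (weakDeriv Ω α v) ⊤ (volume.restrict Ω)).toReal
  else
    (∑ α : Fin k → Fin n,
      (eLpNorm (weakDeriv Ω α v) p (volume.restrict Ω)).toReal ^ p.toReal) ^ (1 / p.toReal)

/-- The affine map `x ↦ A x + b`. -/
noncomputable def affineTransform {n : ℕ} (A : Matrix (Fin n) (Fin n) ℝ) (b : EucSpace n) :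
    EucSpace n → EucSpace n :=
  fun x => Matrix.toEuclideanCLM (𝕜 := ℝ) A x + b

/-- The matrix norm associated with the Euclidean norm. -/
noncomputable def euclideanMatrixNorm {n : ℕ} (A : Matrix (Fin n) (Fin n) ℝ) : ℝ :=
  ‖Matrix.toEuclideanCLM (𝕜 := ℝ) A‖

open Classical in
/-- `τ(p)`, for `1 ≤ p < ∞`. -/
noncomputable def tauExp (p : ℝ) : ℝ := if p ≤ 2 then 1 - p / 2 else 0

open Classical in
/-- `γ(p)`, for `1 ≤ p < ∞`. -/
noncomputable def gammaExp (p : ℝ) : ℝ := if p ≤ 2 then 0 else p / 2 - 1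

open Classical in
/-- `μ(p)`, for `1 ≤ p ≤ ∞`, with `1 / ∞ = 0`. -/
noncomputable def muExp (p : ℝ≥0∞) : ℝ :=
  if p ≤ 2 then (p⁻¹).toReal - 1 / 2 else 1 / 2 - (p⁻¹).toReal

/-! The derivatives of order `k` at a point form a covariant tensor with `n ^ k` entries, and
composition with `φ` acts on it by the `k`-fold tensor power of the transpose of `A`. On `ℓ²` this
operator has norm at most `‖A‖ ^ k` (`sum_sq_tensorPullback_le`). Passing from `ℓ²` to `ℓ^p` takes
one comparison of norms on each side; one is free, the other costs `(n ^ k) ^ μ(p)`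
(`sum_abs_rpow_le`).

For weak derivatives the tensor law holds almost everywhere: move the test function through `φ⁻¹`
and use uniqueness (`HasWeakDeriv.comp_affineTransform`, `HasWeakDeriv.ae_eq`). Integrating the
pointwise bound and changing variables yields the factor `|det A| ^ (-1/p)`; this is the lower
estimate. The upper one is the same estimate for `φ⁻¹`, applied to `v ∘ φ`. -/

/-! ### From `ℓ²` bounds to `ℓ^p` bounds -/

theorem sum_rpow_le_rpow_sum_of_nonneg {ι : Type*} (s : Finset ι) (f : ι → ℝ) (hf : ∀ i, 0 ≤ f i)
    {q : ℝ} (hq : 1 ≤ q) : ∑ i ∈ s, f i ^ q ≤ (∑ i ∈ s, f i) ^ q := by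
  classical
  induction s using Finset.induction_on with
  | empty => simp [Real.zero_rpow (by linarith : q ≠ 0)]
  | insert a s ha ih =>
    rw [Finset.sum_insert ha, Finset.sum_insert ha]
    exact (add_le_add_right ih _).trans
      (Real.add_rpow_le_rpow_add (hf a) (Finset.sum_nonneg fun i _ => hf i) hq)

/-- A bound between Euclidean norms gives one between `ℓ^p` norms, `p ≥ 2`. -/
theorem sum_abs_rpow_le_of_two_le {ι : Type*} [Fintype ι] {x y : ι → ℝ} {C p : ℝ} (hC : 0 ≤ C)
    (hp : 2 ≤ p) (h : ∑ i, y i ^ 2 ≤ C ^ 2 * ∑ i, x i ^ 2) :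
    ∑ i, |y i| ^ p ≤ (Fintype.card ι : ℝ) ^ (p / 2 - 1) * C ^ p * ∑ i, |x i| ^ p := by
  have key : ∀ t : ℝ, |t| ^ p = (t ^ 2) ^ (p / 2) := fun t => by
    rw [← sq_abs, ← Real.rpow_natCast, ← Real.rpow_mul (abs_nonneg t)]
    congr 1
    push_cast
    ring
  have hCp : C ^ p = (C ^ 2) ^ (p / 2) := by rw [← key, abs_of_nonneg hC]
  have hpow := Real.rpow_sum_le_const_mul_sum_rpow Finset.univ (fun i => x i ^ 2)
    (p := p / 2) (by linarith)
  simp only [abs_sq, Finset.card_univ] at hpow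
  simp only [key]
  -- The passage from `ℓ^p` to `ℓ²` for `y` is free; only the power mean inequality for `x` below
  -- costs a power of the cardinality.
  calc ∑ i, (y i ^ 2) ^ (p / 2) ≤ (∑ i, y i ^ 2) ^ (p / 2) :=
        sum_rpow_le_rpow_sum_of_nonneg _ _ (fun i => sq_nonneg _) (by linarith)
    _ ≤ (C ^ 2 * ∑ i, x i ^ 2) ^ (p / 2) :=
        Real.rpow_le_rpow (Finset.sum_nonneg fun i _ => sq_nonneg _) h (by linarith)
    _ = C ^ p * (∑ i, x i ^ 2) ^ (p / 2) := by
        rw [Real.mul_rpow (sq_nonneg C) (Finset.sum_nonneg fun i _ => sq_nonneg _), hCp]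
    _ ≤ C ^ p * ((Fintype.card ι : ℝ) ^ (p / 2 - 1) * ∑ i, (x i ^ 2) ^ (p / 2)) := by
        gcongr
    _ = _ := by ring

/-- A bound between Euclidean norms gives one between `ℓ^p` norms, `1 ≤ p ≤ 2`. -/
theorem sum_abs_rpow_le_of_le_two {ι : Type*} [Fintype ι] {x y : ι → ℝ} {C p : ℝ} (hC : 0 ≤ C)
    (hp1 : 1 ≤ p) (hp : p ≤ 2) (h : ∑ i, y i ^ 2 ≤ C ^ 2 * ∑ i, x i ^ 2) :
    ∑ i, |y i| ^ p ≤ (Fintype.card ι : ℝ) ^ (1 - p / 2) * C ^ p * ∑ i, |x i| ^ p := by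
  have hp0 : 0 < p := by linarith
  have hq : 1 ≤ 2 / p := (one_le_div hp0).2 hp
  have key : ∀ t : ℝ, (|t| ^ p) ^ (2 / p) = t ^ 2 := fun t => by
    rw [← Real.rpow_mul (abs_nonneg t), mul_div_cancel₀ _ hp0.ne', ← sq_abs, ← Real.rpow_natCast]
    norm_cast
  have hnn : ∀ t : ℝ, 0 ≤ |t| ^ p := fun t => by positivity
  have hX : 0 ≤ ∑ i, |x i| ^ p := Finset.sum_nonneg fun i _ => hnn _
  have hY : 0 ≤ ∑ i, |y i| ^ p := Finset.sum_nonneg fun i _ => hnn _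
  have hpow := Real.rpow_sum_le_const_mul_sum_rpow Finset.univ (fun i => |y i| ^ p) hq
  simp only [abs_of_nonneg (hnn _), Finset.card_univ, key] at hpow
  have hx := sum_rpow_le_rpow_sum_of_nonneg Finset.univ (fun i => |x i| ^ p) (fun i => hnn _) hq
  simp only [key] at hx
  have hexp : (1 - p / 2) * (2 / p) = 2 / p - 1 := by field_simp
  -- Raising to the power `2 / p ≥ 1` turns `|t| ^ p` into `t ^ 2`. The roles are now exchanged: the
  -- power mean inequality is spent on `y`, and the comparison for `x` is free.
  rw [← Real.rpow_le_rpow_iff hY (by positivity) (by positivity : (0 : ℝ) < 2 / p),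
    Real.mul_rpow (by positivity) hX, Real.mul_rpow (by positivity) (by positivity),
    ← Real.rpow_mul (by positivity), hexp, ← abs_of_nonneg hC, key]
  calc _ ≤ _ := hpow
    _ ≤ (Fintype.card ι : ℝ) ^ (2 / p - 1) * (C ^ 2 * (∑ i, |x i| ^ p) ^ (2 / p)) := by
      gcongr
      exact h.trans (by gcongr)
    _ = _ := by ring

/-! ### Tensor pull-back and its `ℓ²` norm -/

/-- The pull-back of a covariant tensor of order `m` by the matrix `A`, in coordinates. -/
noncomputable def tensorPullback {n m : ℕ} (A : Matrix (Fin n) (Fin n) ℝ)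
    (T : (Fin m → Fin n) → ℝ) (β : Fin m → Fin n) : ℝ :=
  ∑ α : Fin m → Fin n, (∏ i, A (α i) (β i)) * T α

/-- The transpose is the adjoint, which has the same operator norm. -/
theorem sum_sq_transpose_mulVec_le {n : ℕ} (A : Matrix (Fin n) (Fin n) ℝ) (x : Fin n → ℝ) :
    ∑ j, (∑ i, A i j * x i) ^ 2 ≤ euclideanMatrixNorm A ^ 2 * ∑ i, x i ^ 2 := by
  have hn : ‖Matrix.toEuclideanCLM (𝕜 := ℝ) (star A)‖ = euclideanMatrixNorm A := by
    rw [map_star, ContinuousLinearMap.star_eq_adjoint, LinearIsometryEquiv.norm_map,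
      euclideanMatrixNorm]
  have h := (Matrix.toEuclideanCLM (𝕜 := ℝ) (star A)).le_opNorm (WithLp.toLp 2 x)
  rw [hn] at h
  have h2 := pow_le_pow_left₀ (norm_nonneg _) h 2
  rw [mul_pow, EuclideanSpace.real_norm_sq_eq, EuclideanSpace.real_norm_sq_eq] at h2
  simpa [Matrix.toEuclideanCLM_toLp, Matrix.mulVec, dotProduct, Matrix.star_apply] using h2

theorem sum_fin_succ_fun {n m : ℕ} (f : (Fin (m + 1) → Fin n) → ℝ) :
    ∑ α, f α = ∑ i : Fin n, ∑ α : Fin m → Fin n, f (Fin.cons i α) := by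
  rw [← Fintype.sum_prod_type']
  exact (Fintype.sum_equiv (Fin.consEquiv fun _ => Fin n) _ _ fun _ => rfl).symm

/-- Induction on the order: the transpose acts on the first slot with the other indices fixed, and
the induction hypothesis handles the remaining slots. -/
theorem sum_sq_tensorPullback_le {n : ℕ} (A : Matrix (Fin n) (Fin n) ℝ) (m : ℕ)
    (T : (Fin m → Fin n) → ℝ) :
    ∑ β, tensorPullback A T β ^ 2 ≤ (euclideanMatrixNorm A ^ m) ^ 2 * ∑ α, T α ^ 2 := by
  induction m with
  | zero => simp [tensorPullback]
  | succ m ih =>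
    have hstep : ∀ (j : Fin n) (β : Fin m → Fin n), tensorPullback A T (Fin.cons j β) =
        ∑ i, A i j * tensorPullback A (fun α => T (Fin.cons i α)) β := fun j β => by
      simp only [tensorPullback, sum_fin_succ_fun, Fin.prod_univ_succ, Fin.cons_zero,
        Fin.cons_succ, Finset.mul_sum, mul_assoc]
    rw [sum_fin_succ_fun, sum_fin_succ_fun]
    simp only [hstep]
    rw [Finset.sum_comm]
    calc _ ≤ ∑ β : Fin m → Fin n, euclideanMatrixNorm A ^ 2 *
          ∑ i, tensorPullback A (fun α => T (Fin.cons i α)) β ^ 2 :=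
          Finset.sum_le_sum fun β _ => sum_sq_transpose_mulVec_le A _
      _ = euclideanMatrixNorm A ^ 2 *
          ∑ i, ∑ β, tensorPullback A (fun α => T (Fin.cons i α)) β ^ 2 := by
          rw [← Finset.mul_sum, Finset.sum_comm]
      _ ≤ euclideanMatrixNorm A ^ 2 * ∑ i, (euclideanMatrixNorm A ^ m) ^ 2 *
          ∑ α, T (Fin.cons i α) ^ 2 := by
          gcongr with i
          exact ih _
      _ = _ := by rw [← Finset.mul_sum]; ring

theorem euclideanMatrixNorm_nonneg {n : ℕ} (A : Matrix (Fin n) (Fin n) ℝ) :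
    0 ≤ euclideanMatrixNorm A := norm_nonneg _

/-! ### Affine maps: chain rule and change of variables -/

theorem affineTransform_eq_comp {n : ℕ} (A : Matrix (Fin n) (Fin n) ℝ) (b : EucSpace n) :
    affineTransform A b = (fun x => x + b) ∘ Matrix.toEuclideanCLM (𝕜 := ℝ) A := rfl

theorem contDiff_affineTransform {n : ℕ} (A : Matrix (Fin n) (Fin n) ℝ) (b : EucSpace n) :
    ContDiff ℝ ∞ (affineTransform A b) :=
  (ContinuousLinearMap.contDiff _).add contDiff_const

theorem toEuclideanCLM_single {n : ℕ} (A : Matrix (Fin n) (Fin n) ℝ) (j : Fin n) :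
    Matrix.toEuclideanCLM (𝕜 := ℝ) A (EuclideanSpace.single j 1) =
      ∑ i, A i j • EuclideanSpace.single i (1 : ℝ) := by
  ext l
  simp [Matrix.ofLp_toEuclideanCLM, Pi.single_apply]

/-- The derivative of `φ` is constant, so the chain rule has no lower-order terms; expanding each `A
e_j` by multilinearity gives the tensor law. -/
theorem partialDeriv_comp_affineTransform {n m : ℕ} (A : Matrix (Fin n) (Fin n) ℝ)
    (b : EucSpace n) {F : EucSpace n → ℝ} (hF : ContDiff ℝ ∞ F) (β : Fin m → Fin n)
    (x : EucSpace n) :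
    partialDeriv β (F ∘ affineTransform A b) x =
      tensorPullback A (fun α => partialDeriv α F (affineTransform A b x)) β := by
  have h1 : iteratedFDeriv ℝ m (F ∘ affineTransform A b) x =
      (iteratedFDeriv ℝ m F (affineTransform A b x)).compContinuousLinearMap
        fun _ => Matrix.toEuclideanCLM (𝕜 := ℝ) A := by
    rw [affineTransform_eq_comp, ← Function.comp_assoc,
      ContinuousLinearMap.iteratedFDeriv_comp_right (n := ∞) _ _ x (by exact_mod_cast le_top)]
    · congr 1
      exact iteratedFDeriv_comp_add_right m b _
    · exact hF.comp (contDiff_id.add contDiff_const)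
  simp only [partialDeriv, h1, ContinuousMultilinearMap.compContinuousLinearMap_apply,
    toEuclideanCLM_single, ContinuousMultilinearMap.map_sum,
    ContinuousMultilinearMap.map_smul_univ, tensorPullback, smul_eq_mul]

theorem toEuclideanCLM_inv_apply {n : ℕ} {A : Matrix (Fin n) (Fin n) ℝ} (hA : A.det ≠ 0)
    (x : EucSpace n) :
    Matrix.toEuclideanCLM (𝕜 := ℝ) A⁻¹ (Matrix.toEuclideanCLM (𝕜 := ℝ) A x) = x := by
  rw [← mul_apply_eq_comp, ← map_mul, Matrix.nonsing_inv_mul A hA.isUnit, map_one,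
    one_apply_eq_self]

theorem toEuclideanCLM_apply_inv {n : ℕ} {A : Matrix (Fin n) (Fin n) ℝ} (hA : A.det ≠ 0)
    (x : EucSpace n) :
    Matrix.toEuclideanCLM (𝕜 := ℝ) A (Matrix.toEuclideanCLM (𝕜 := ℝ) A⁻¹ x) = x := by
  rw [← mul_apply_eq_comp, ← map_mul, Matrix.mul_nonsing_inv A hA.isUnit, map_one,
    one_apply_eq_self]

/-- The map `x ↦ A x + b` as a homeomorphism, with inverse `y ↦ A⁻¹ y - A⁻¹ b`. -/
noncomputable def matrixAffineHomeomorph {n : ℕ} (A : Matrix (Fin n) (Fin n) ℝ) (hA : A.det ≠ 0)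
    (b : EucSpace n) : EucSpace n ≃ₜ EucSpace n where
  toFun := affineTransform A b
  invFun := affineTransform A⁻¹ (-Matrix.toEuclideanCLM (𝕜 := ℝ) A⁻¹ b)
  left_inv x := by simp [affineTransform, toEuclideanCLM_inv_apply hA]
  right_inv x := by simp [affineTransform, toEuclideanCLM_apply_inv hA]
  continuous_toFun := (contDiff_affineTransform A b).continuous
  continuous_invFun := (contDiff_affineTransform _ _).continuous

theorem map_volume_affineTransform {n : ℕ} {A : Matrix (Fin n) (Fin n) ℝ} (hA : A.det ≠ 0)
    (b : EucSpace n) :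
    (volume : Measure (EucSpace n)).map (affineTransform A b) =
      ENNReal.ofReal |A.det|⁻¹ • volume := by
  have hdet : LinearMap.det (Matrix.toEuclideanCLM (𝕜 := ℝ) A : EucSpace n →ₗ[ℝ] EucSpace n) =
      A.det := by
    rw [Matrix.coe_toEuclideanCLM_eq_toEuclideanLin, Matrix.toEuclideanLin,
      Matrix.toLpLin_eq_toLin, LinearMap.det_toLin]
  have h := Measure.map_linearMap_addHaar_eq_smul_addHaar (volume : Measure (EucSpace n))
    (f := (Matrix.toEuclideanCLM (𝕜 := ℝ) A : EucSpace n →ₗ[ℝ] EucSpace n)) (by rwa [hdet])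
  rw [hdet, abs_inv] at h
  rw [affineTransform_eq_comp, ← Measure.map_map (measurable_add_const b)
    (ContinuousLinearMap.measurable _)]
  refine (congrArg (Measure.map fun x => x + b) h).trans ?_
  rw [Measure.map_smul, map_add_right_eq_self]

theorem measurableEmbedding_affineTransform {n : ℕ} {A : Matrix (Fin n) (Fin n) ℝ}
    (hA : A.det ≠ 0) (b : EucSpace n) : MeasurableEmbedding (affineTransform A b) :=
  (matrixAffineHomeomorph A hA b).measurableEmbedding

theorem injective_affineTransform {n : ℕ} {A : Matrix (Fin n) (Fin n) ℝ} (hA : A.det ≠ 0)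
    (b : EucSpace n) : Function.Injective (affineTransform A b) :=
  (matrixAffineHomeomorph A hA b).injective

theorem map_restrict_affineTransform {n : ℕ} {A : Matrix (Fin n) (Fin n) ℝ} (hA : A.det ≠ 0)
    (b : EucSpace n) (s : Set (EucSpace n)) :
    ((volume : Measure (EucSpace n)).restrict s).map (affineTransform A b) =
      ENNReal.ofReal |A.det|⁻¹ • volume.restrict (affineTransform A b '' s) := by
  rw [← Measure.restrict_smul, ← map_volume_affineTransform hA b,
    (measurableEmbedding_affineTransform hA b).restrict_map,
    (injective_affineTransform hA b).preimage_image]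

theorem setIntegral_comp_affineTransform {n : ℕ} {A : Matrix (Fin n) (Fin n) ℝ} (hA : A.det ≠ 0)
    (b : EucSpace n) (s : Set (EucSpace n)) (f : EucSpace n → ℝ) :
    ∫ x in s, f (affineTransform A b x) =
      |A.det|⁻¹ * ∫ x in affineTransform A b '' s, f x := by
  rw [← (measurableEmbedding_affineTransform hA b).integral_map,
    map_restrict_affineTransform hA, integral_smul_measure, smul_eq_mul,
    ENNReal.toReal_ofReal (by positivity)]

theorem memLp_comp_affineTransform {n : ℕ} {A : Matrix (Fin n) (Fin n) ℝ} (hA : A.det ≠ 0)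
    (b : EucSpace n) {s : Set (EucSpace n)} {f : EucSpace n → ℝ} {p : ℝ≥0∞}
    (hf : MemLp f p (volume.restrict (affineTransform A b '' s))) :
    MemLp (f ∘ affineTransform A b) p (volume.restrict s) := by
  refine MemLp.comp_of_map ?_ (measurableEmbedding_affineTransform hA b).measurable.aemeasurable
  rw [map_restrict_affineTransform hA]
  exact hf.smul_measure ENNReal.ofReal_ne_top

theorem ae_restrict_comp_affineTransform {n : ℕ} {A : Matrix (Fin n) (Fin n) ℝ}
    (hA : A.det ≠ 0) (b : EucSpace n) {s : Set (EucSpace n)} {P : EucSpace n → Prop}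
    (h : ∀ᵐ y ∂volume.restrict (affineTransform A b '' s), P y) :
    ∀ᵐ x ∂volume.restrict s, P (affineTransform A b x) := by
  rw [← (measurableEmbedding_affineTransform hA b).ae_map_iff, map_restrict_affineTransform hA]
  exact Measure.ae_smul_measure h _

theorem isOpen_image_affineTransform {n : ℕ} {A : Matrix (Fin n) (Fin n) ℝ}
    (hA : A.det ≠ 0) (b : EucSpace n) {s : Set (EucSpace n)} (hs : IsOpen s) :
    IsOpen (affineTransform A b '' s) :=
  (matrixAffineHomeomorph A hA b).isOpenMap s hs

theorem locallyIntegrableOn_comp_affineTransform {n : ℕ} {A : Matrix (Fin n) (Fin n) ℝ}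
    (hA : A.det ≠ 0) (b : EucSpace n) {s : Set (EucSpace n)} (hs : IsOpen s)
    {f : EucSpace n → ℝ} (hf : LocallyIntegrableOn f (affineTransform A b '' s)) :
    LocallyIntegrableOn (f ∘ affineTransform A b) s := by
  rw [locallyIntegrableOn_iff hs.isLocallyClosed]
  intro K hK hKc
  have h := hf.integrableOn_compact_subset (Set.image_mono hK)
    (hKc.image (contDiff_affineTransform A b).continuous)
  rw [IntegrableOn, ← memLp_one_iff_integrable] at h ⊢
  exact memLp_comp_affineTransform hA b h

/-! ### Test functions and weak derivatives -/

theorem IsTestFunction.comp_inverse {n : ℕ} {A : Matrix (Fin n) (Fin n) ℝ}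
    (hA : A.det ≠ 0) (b : EucSpace n) {s : Set (EucSpace n)} {f : EucSpace n → ℝ}
    (hf : IsTestFunction s f) :
    IsTestFunction (affineTransform A b '' s) (f ∘ (matrixAffineHomeomorph A hA b).symm) := by
  refine ⟨hf.1.comp (contDiff_affineTransform _ _), hf.2.1.comp_homeomorph _, ?_⟩
  rw [tsupport_comp_eq_preimage]
  intro y hy
  exact ⟨_, hf.2.2 hy, (matrixAffineHomeomorph A hA b).apply_symm_apply y⟩

theorem LocallyIntegrableOn.integrableOn_mul_of_support_subset {n : ℕ} {Ω : Set (EucSpace n)}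
    {v h : EucSpace n → ℝ} (hv : LocallyIntegrableOn v Ω) (hh : Continuous h)
    {K : Set (EucSpace n)} (hK : IsCompact K) (hKΩ : K ⊆ Ω) (hsupp : Function.support h ⊆ K) :
    IntegrableOn (fun x => v x * h x) Ω := by
  have h1 : IntegrableOn (fun x => v x * h x) K :=
    (hv.integrableOn_compact_subset hKΩ hK).mul_continuousOn hh.continuousOn hK
  exact ((integrableOn_iff_integrable_of_support_subset
    ((Function.support_mul_subset_right v h).trans hsupp)).1 h1).integrableOn

theorem IsTestFunction.integrableOn_mul {n : ℕ} {Ω : Set (EucSpace n)} {v f : EucSpace n → ℝ}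
    (hf : IsTestFunction Ω f) (hv : LocallyIntegrableOn v Ω) :
    IntegrableOn (fun x => v x * f x) Ω :=
  LocallyIntegrableOn.integrableOn_mul_of_support_subset hv hf.1.continuous hf.2.1 hf.2.2
    (subset_tsupport f)

theorem IsTestFunction.integrableOn_mul_partialDeriv {n m : ℕ} {Ω : Set (EucSpace n)}
    {v f : EucSpace n → ℝ} (hf : IsTestFunction Ω f) (hv : LocallyIntegrableOn v Ω)
    (α : Fin m → Fin n) : IntegrableOn (fun x => v x * partialDeriv α f x) Ω := by
  refine LocallyIntegrableOn.integrableOn_mul_of_support_subset hv ?_ hf.2.1 hf.2.2 ?_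
  · exact (ContinuousMultilinearMap.apply ℝ (fun _ : Fin m => EucSpace n) ℝ
      (fun i => EuclideanSpace.single (α i) (1 : ℝ))).continuous.comp
      (hf.1.continuous_iteratedFDeriv (by exact_mod_cast le_top))
  · refine Set.Subset.trans (fun x hx => ?_) (support_iteratedFDeriv_subset (𝕜 := ℝ) m)
    rw [Function.mem_support] at hx ⊢
    contrapose! hx
    simp [partialDeriv, hx]

/-- The chain rule for weak derivatives of order `m` under an affine change of variables. -/
theorem HasWeakDeriv.comp_affineTransform {n m : ℕ} {A : Matrix (Fin n) (Fin n) ℝ}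
    (hA : A.det ≠ 0) (b : EucSpace n) {s : Set (EucSpace n)} (hs : IsOpen s)
    {v : EucSpace n → ℝ} {g : (Fin m → Fin n) → EucSpace n → ℝ}
    (hv : LocallyIntegrableOn v (affineTransform A b '' s))
    (hg : ∀ α, HasWeakDeriv (affineTransform A b '' s) α v (g α)) (β : Fin m → Fin n) :
    HasWeakDeriv s β (v ∘ affineTransform A b)
      (fun x => tensorPullback A (fun α => g α (affineTransform A b x)) β) := by
  refine ⟨locallyIntegrableOn_comp_affineTransform hA b hs hv, ?_, fun f hf => ?_⟩
  · rw [locallyIntegrableOn_iff hs.isLocallyClosed]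
    intro K hK hKc
    refine integrable_finsetSum _ fun α _ => Integrable.const_mul ?_ _
    exact (locallyIntegrableOn_comp_affineTransform hA b hs
      (hg α).2.1).integrableOn_compact_subset hK hKc
  -- Since `f = F ∘ φ`, the classical tensor law expresses the derivatives of `f` by those of `F`,
  -- against which the weak derivatives of `v` can be tested.
  · set F := f ∘ (matrixAffineHomeomorph A hA b).symm
    have hFt : IsTestFunction (affineTransform A b '' s) F := hf.comp_inverse hA b
    have hfF : f = F ∘ affineTransform A b := by
      ext x
      exact congrArg f ((matrixAffineHomeomorph A hA b).symm_apply_apply x).symm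
    have h1 : ∀ x, (v ∘ affineTransform A b) x * partialDeriv β f x =
        (fun y => ∑ α : Fin m → Fin n, (∏ i, A (α i) (β i)) * (v y * partialDeriv α F y))
          (affineTransform A b x) := fun x => by
      rw [hfF, partialDeriv_comp_affineTransform A b hFt.1]
      simp only [tensorPullback, Finset.mul_sum, Function.comp_apply]
      exact Finset.sum_congr rfl fun α _ => by ring
    have h2 : ∀ x, tensorPullback A (fun α => g α (affineTransform A b x)) β * f x =
        (fun y => ∑ α : Fin m → Fin n, (∏ i, A (α i) (β i)) * (g α y * F y))
          (affineTransform A b x) := fun x => by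
      rw [hfF]
      simp only [tensorPullback, Finset.sum_mul, Function.comp_apply, mul_assoc]
    have e1 := (integral_congr_ae (μ := volume.restrict s) (Filter.Eventually.of_forall h1)).trans
      (setIntegral_comp_affineTransform hA b s
        fun y => ∑ α : Fin m → Fin n, (∏ i, A (α i) (β i)) * (v y * partialDeriv α F y))
    have e2 := (integral_congr_ae (μ := volume.restrict s) (Filter.Eventually.of_forall h2)).trans
      (setIntegral_comp_affineTransform hA b s
        fun y => ∑ α : Fin m → Fin n, (∏ i, A (α i) (β i)) * (g α y * F y))
    rw [e1, e2,
      integral_finsetSum _ fun α _ => (hFt.integrableOn_mul_partialDeriv hv α).const_mul _,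
      integral_finsetSum _ fun α _ => (hFt.integrableOn_mul (hg α).2.1).const_mul _,
      mul_left_comm, Finset.mul_sum _ _ ((-1 : ℝ) ^ m)]
    congr 1
    refine Finset.sum_congr rfl fun α _ => ?_
    rw [integral_const_mul, integral_const_mul, (hg α).2.2 F hFt]
    ring

/-- Weak derivatives are unique almost everywhere. -/
theorem HasWeakDeriv.ae_eq {n m : ℕ} {Ω : Set (EucSpace n)} (hΩ : IsOpen Ω) {α : Fin m → Fin n}
    {v g h : EucSpace n → ℝ} (hg : HasWeakDeriv Ω α v g) (hh : HasWeakDeriv Ω α v h) :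
    g =ᵐ[volume.restrict Ω] h := by
  have key := hΩ.ae_eq_zero_of_integral_contDiff_smul_eq_zero (hg.2.1.sub hh.2.1)
    -- The fundamental lemma of the calculus of variations is applied to `g - h`.
    (fun f hf1 hf2 hf3 => ?_)
  · rw [Filter.EventuallyEq, ae_restrict_iff' hΩ.measurableSet]
    filter_upwards [key] with x hx hxΩ
    exact sub_eq_zero.1 (hx hxΩ)
  · have hf : IsTestFunction Ω f := ⟨hf1, hf2, hf3⟩
    have e : ∫ x in Ω, g x * f x = ∫ x in Ω, h x * f x := by
      have h1 := (hg.2.2 f hf).symm.trans (hh.2.2 f hf)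
      exact mul_left_cancel₀ (pow_ne_zero m (by norm_num)) h1
    rw [← setIntegral_eq_integral_of_forall_compl_eq_zero (s := Ω)]
    · have : ∀ x, f x • (g - h) x = g x * f x - h x * f x := fun x => by
        simp only [Pi.sub_apply, smul_eq_mul]
        ring
      simp only [this]
      rw [integral_sub (hf.integrableOn_mul hg.2.1) (hf.integrableOn_mul hh.2.1), e, sub_self]
    · intro x hx
      rw [image_eq_zero_of_notMem_tsupport fun hx' => hx (hf3 hx'), zero_smul]

theorem HasWeakDeriv.weakDeriv_ae_eq {n m : ℕ} {Ω : Set (EucSpace n)} (hΩ : IsOpen Ω)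
    {α : Fin m → Fin n} {v g : EucSpace n → ℝ} (hg : HasWeakDeriv Ω α v g) :
    weakDeriv Ω α v =ᵐ[volume.restrict Ω] g := by
  have hex : ∃ g : EucSpace n → ℝ, HasWeakDeriv Ω α v g := ⟨g, hg⟩
  rw [weakDeriv, dif_pos hex]
  exact hex.choose_spec.ae_eq hΩ hg

theorem MemSobolev.hasWeakDeriv_weakDeriv {n k m : ℕ} {p : ℝ≥0∞} {Ω : Set (EucSpace n)}
    {v : EucSpace n → ℝ} (hv : MemSobolev k p Ω v) (hm : m ≤ k) (α : Fin m → Fin n) :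
    HasWeakDeriv Ω α v (weakDeriv Ω α v) := by
  obtain ⟨g, hg, -⟩ := hv.2 m hm α
  have hex : ∃ g : EucSpace n → ℝ, HasWeakDeriv Ω α v g := ⟨g, hg⟩
  rw [weakDeriv, dif_pos hex]
  exact hex.choose_spec

theorem MemSobolev.memLp_weakDeriv {n k m : ℕ} {p : ℝ≥0∞} {Ω : Set (EucSpace n)} (hΩ : IsOpen Ω)
    {v : EucSpace n → ℝ} (hv : MemSobolev k p Ω v) (hm : m ≤ k) (α : Fin m → Fin n) :
    MemLp (weakDeriv Ω α v) p (volume.restrict Ω) := by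
  obtain ⟨g, hg, hgp⟩ := hv.2 m hm α
  exact hgp.ae_eq (hg.weakDeriv_ae_eq hΩ).symm

/-- The order-zero clause of `MemSobolev` already contains this, so no inclusion of `L^p` in
`L¹_loc` is needed. -/
theorem MemSobolev.locallyIntegrableOn {n k : ℕ} {p : ℝ≥0∞} {Ω : Set (EucSpace n)}
    {v : EucSpace n → ℝ} (hv : MemSobolev k p Ω v) : LocallyIntegrableOn v Ω := by
  obtain ⟨g, hg, -⟩ := hv.2 0 k.zero_le Fin.elim0
  exact hg.1

theorem MemSobolev.comp_affineTransform {n k : ℕ} {p : ℝ≥0∞} {A : Matrix (Fin n) (Fin n) ℝ}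
    (hA : A.det ≠ 0) (b : EucSpace n) {s : Set (EucSpace n)} (hs : IsOpen s)
    {v : EucSpace n → ℝ} (hv : MemSobolev k p (affineTransform A b '' s) v) :
    MemSobolev k p s (v ∘ affineTransform A b) := by
  refine ⟨memLp_comp_affineTransform hA b hv.1, fun m hm β => ⟨_,
    HasWeakDeriv.comp_affineTransform hA b hs hv.locallyIntegrableOn
      (fun α => hv.hasWeakDeriv_weakDeriv hm α) β, ?_⟩⟩
  refine memLp_finsetSum _ fun α _ => MemLp.const_mul ?_ _
  exact memLp_comp_affineTransform hA b
    (hv.memLp_weakDeriv (isOpen_image_affineTransform hA b hs) hm α)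

/-- The weak derivatives of order `k` of `v ∘ φ`, with `φ` affine, are almost everywhere the
pull-back of those of `v`. -/
theorem MemSobolev.weakDeriv_comp_affineTransform {n k : ℕ} {p : ℝ≥0∞}
    {A : Matrix (Fin n) (Fin n) ℝ}
    (hA : A.det ≠ 0) (b : EucSpace n) {s : Set (EucSpace n)} (hs : IsOpen s)
    {v : EucSpace n → ℝ} (hv : MemSobolev k p (affineTransform A b '' s) v) :
    ∀ᵐ x ∂volume.restrict s, ∀ β : Fin k → Fin n,
      weakDeriv s β (v ∘ affineTransform A b) x = tensorPullback A
        (fun α => weakDeriv (affineTransform A b '' s) α v (affineTransform A b x)) β :=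
  ae_all_iff.2 fun β => (HasWeakDeriv.comp_affineTransform hA b hs hv.locallyIntegrableOn
    (fun α => hv.hasWeakDeriv_weakDeriv le_rfl α) β).weakDeriv_ae_eq hs

/-! ### The one-sided seminorm estimate -/

theorem muExp_eq_div {p : ℝ≥0∞} (hp : 1 ≤ p) (hp' : p ≠ ⊤) :
    muExp p = (tauExp p.toReal + gammaExp p.toReal) / p.toReal := by
  have h0 : 0 < p.toReal := ENNReal.toReal_pos (by positivity) hp'
  have hiff : p.toReal ≤ 2 ↔ p ≤ 2 := by
    rw [← ENNReal.toReal_ofNat, ENNReal.toReal_le_toReal hp' (by simp)]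
  simp only [muExp, tauExp, gammaExp, hiff, ENNReal.toReal_inv]
  split_ifs <;> field_simp <;> ring

theorem sum_abs_rpow_le {ι : Type*} [Fintype ι] {x y : ι → ℝ} {C : ℝ} (hC : 0 ≤ C)
    {p : ℝ≥0∞} (hp : 1 ≤ p) (hp' : p ≠ ⊤) (h : ∑ i, y i ^ 2 ≤ C ^ 2 * ∑ i, x i ^ 2) :
    ∑ i, |y i| ^ p.toReal ≤
      ((Fintype.card ι : ℝ) ^ muExp p * C) ^ p.toReal * ∑ i, |x i| ^ p.toReal := by
  have h0 : 0 < p.toReal := ENNReal.toReal_pos (by positivity) hp'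
  have h1 : 1 ≤ p.toReal := by
    simpa using (ENNReal.toReal_le_toReal ENNReal.one_ne_top hp').2 hp
  -- The `p`-th power turns the exponent `μ(p)` into `τ(p) + γ(p)`, one of which vanishes in each
  -- range.
  rw [Real.mul_rpow (by positivity) hC, ← Real.rpow_mul (by positivity), muExp_eq_div hp hp',
    div_mul_cancel₀ _ h0.ne', tauExp, gammaExp]
  split_ifs with h2
  · rw [add_zero]
    exact sum_abs_rpow_le_of_le_two hC h1 h2 h
  · rw [zero_add]
    exact sum_abs_rpow_le_of_two_le hC (by linarith) h

theorem toReal_eLpNorm_rpow {n : ℕ} {μ : Measure (EucSpace n)} {f : EucSpace n → ℝ} {p : ℝ≥0∞}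
    (hp : 1 ≤ p) (hp' : p ≠ ⊤) (hf : MemLp f p μ) :
    (eLpNorm f p μ).toReal ^ p.toReal = ∫ x, |f x| ^ p.toReal ∂μ := by
  have h0 : 0 < p.toReal := ENNReal.toReal_pos (by positivity) hp'
  have hi : 0 ≤ ∫ x, |f x| ^ p.toReal ∂μ := integral_nonneg fun x => by positivity
  rw [hf.eLpNorm_eq_integral_rpow_norm (by positivity) hp']
  simp only [Real.norm_eq_abs]
  rw [ENNReal.toReal_ofReal (by positivity), Real.rpow_inv_rpow hi h0.ne']

theorem integrable_abs_rpow {n : ℕ} {μ : Measure (EucSpace n)} {f : EucSpace n → ℝ} {p : ℝ≥0∞}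
    (hp : 1 ≤ p) (hp' : p ≠ ⊤) (hf : MemLp f p μ) :
    Integrable (fun x => |f x| ^ p.toReal) μ :=
  hf.integrable_norm_rpow (by positivity) hp'

theorem MemSobolev.sobolevSeminorm_eq {n k : ℕ} {p : ℝ≥0∞} (hp : 1 ≤ p) (hp' : p ≠ ⊤)
    {Ω : Set (EucSpace n)} (hΩ : IsOpen Ω) {v : EucSpace n → ℝ} (hv : MemSobolev k p Ω v) :
    sobolevSeminorm k p Ω v =
      (∫ x in Ω, ∑ α : Fin k → Fin n, |weakDeriv Ω α v x| ^ p.toReal) ^ (1 / p.toReal) := by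
  rw [sobolevSeminorm, if_neg hp', integral_finsetSum _ fun α _ =>
    integrable_abs_rpow hp hp' (hv.memLp_weakDeriv hΩ le_rfl α)]
  congr 1
  exact Finset.sum_congr rfl fun α _ =>
    toReal_eLpNorm_rpow hp hp' (hv.memLp_weakDeriv hΩ le_rfl α)

theorem sobolevSeminorm_comp_affineTransform_le_of_ne_top {n k : ℕ} {p : ℝ≥0∞} (hp : 1 ≤ p)
    (hp' : p ≠ ⊤) {A : Matrix (Fin n) (Fin n) ℝ} (hA : A.det ≠ 0) (b : EucSpace n)
    {s : Set (EucSpace n)} (hs : IsOpen s) {v : EucSpace n → ℝ}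
    (hv : MemSobolev k p (affineTransform A b '' s) v) :
    sobolevSeminorm k p s (v ∘ affineTransform A b) ≤
      ((n ^ k : ℕ) : ℝ) ^ muExp p * euclideanMatrixNorm A ^ k * (|A.det|⁻¹ ^ (p⁻¹).toReal *
        sobolevSeminorm k p (affineTransform A b '' s) v) := by
  have h0 : 0 < p.toReal := ENNReal.toReal_pos (by positivity) hp'
  have hN : 0 ≤ euclideanMatrixNorm A ^ k := pow_nonneg (euclideanMatrixNorm_nonneg A) k
  have hΩ := isOpen_image_affineTransform hA b hs
  have hv' := hv.comp_affineTransform hA b hs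
  set C : ℝ := ((n ^ k : ℕ) : ℝ) ^ muExp p * euclideanMatrixNorm A ^ k
  have hC0 : 0 ≤ C := by positivity
  set G : EucSpace n → ℝ := fun y => ∑ α : Fin k → Fin n,
    |weakDeriv (affineTransform A b '' s) α v y| ^ p.toReal
  have hG0 : ∀ y, 0 ≤ G y := fun y => Finset.sum_nonneg fun α _ => by positivity
  have hGi : Integrable (fun x => G (affineTransform A b x)) (volume.restrict s) :=
    integrable_finsetSum _ fun α _ => integrable_abs_rpow hp hp'
      (memLp_comp_affineTransform hA b (hv.memLp_weakDeriv hΩ le_rfl α))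
  rw [hv.sobolevSeminorm_eq hp hp' hΩ, hv'.sobolevSeminorm_eq hp hp' hs]
  have hle : ∫ x in s, ∑ β : Fin k → Fin n,
        |weakDeriv s β (v ∘ affineTransform A b) x| ^ p.toReal ≤
      C ^ p.toReal * (|A.det|⁻¹ * ∫ y in affineTransform A b '' s, G y) := by
    rw [← setIntegral_comp_affineTransform hA, ← integral_const_mul]
    refine integral_mono_ae (integrable_finsetSum _ fun α _ => integrable_abs_rpow hp hp'
      (hv'.memLp_weakDeriv hs le_rfl α)) (hGi.const_mul _) ?_
    filter_upwards [hv.weakDeriv_comp_affineTransform hA b hs] with x hx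
    simp only [hx]
    have := sum_abs_rpow_le hN hp hp' (sum_sq_tensorPullback_le A k
      fun α => weakDeriv (affineTransform A b '' s) α v (affineTransform A b x))
    simpa only [Fintype.card_fun, Fintype.card_fin] using this
  have hI : 0 ≤ ∫ y in affineTransform A b '' s, G y := integral_nonneg hG0
  refine (Real.rpow_le_rpow (integral_nonneg fun x => Finset.sum_nonneg fun α _ => by positivity)
    hle (by positivity)).trans_eq ?_
  rw [Real.mul_rpow (by positivity) (by positivity), Real.mul_rpow (by positivity) hI,
    ← Real.rpow_mul hC0, mul_one_div_cancel h0.ne', Real.rpow_one, ENNReal.toReal_inv,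
    one_div]

/-- One entry is at most the `ℓ²` norm of the pulled-back tensor, and `n ^ k` entries bounded by `S`
have `ℓ²` norm at most `(n ^ k) ^ (1/2) * S`. -/
theorem sobolevSeminorm_comp_affineTransform_le_of_top {n k : ℕ}
    {A : Matrix (Fin n) (Fin n) ℝ} (hA : A.det ≠ 0) (b : EucSpace n)
    {s : Set (EucSpace n)} (hs : IsOpen s) {v : EucSpace n → ℝ}
    (hv : MemSobolev k ⊤ (affineTransform A b '' s) v) :
    sobolevSeminorm k ⊤ s (v ∘ affineTransform A b) ≤
      ((n ^ k : ℕ) : ℝ) ^ (1 / 2 : ℝ) * euclideanMatrixNorm A ^ k *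
        sobolevSeminorm k ⊤ (affineTransform A b '' s) v := by
  have hN : 0 ≤ euclideanMatrixNorm A ^ k := pow_nonneg (euclideanMatrixNorm_nonneg A) k
  have hΩ := isOpen_image_affineTransform hA b hs
  set Ω := affineTransform A b '' s
  have hbdd : BddAbove (Set.range fun α : Fin k → Fin n =>
      (eLpNorm (weakDeriv Ω α v) ⊤ (volume.restrict Ω)).toReal) := (Set.finite_range _).bddAbove
  set S : ℝ := sobolevSeminorm k ⊤ Ω v with hS
  rw [sobolevSeminorm, if_pos rfl] at hS
  have hS0 : 0 ≤ S := hS ▸ Real.iSup_nonneg fun α => ENNReal.toReal_nonneg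
  have hae : ∀ᵐ y ∂volume.restrict Ω, ∀ α : Fin k → Fin n, |weakDeriv Ω α v y| ≤ S := by
    refine ae_all_iff.2 fun α => ?_
    have hm := hv.memLp_weakDeriv hΩ le_rfl α
    filter_upwards [enorm_ae_le_eLpNormEssSup (weakDeriv Ω α v) (volume.restrict Ω)] with y hy
    rw [← eLpNorm_exponent_top] at hy
    have := ENNReal.toReal_mono hm.eLpNorm_ne_top hy
    rw [toReal_enorm, Real.norm_eq_abs] at this
    exact this.trans (hS ▸ le_ciSup hbdd α)
  rw [sobolevSeminorm, if_pos rfl]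
  refine Real.iSup_le (fun β => ?_) (by positivity)
  rw [eLpNorm_exponent_top]
  refine ENNReal.toReal_le_of_le_ofReal (by positivity) (eLpNormEssSup_le_of_ae_bound ?_)
  filter_upwards [hv.weakDeriv_comp_affineTransform hA b hs,
    ae_restrict_comp_affineTransform hA b hae] with x hx hxS
  rw [hx, Real.norm_eq_abs]
  refine abs_le_of_sq_le_sq' ?_ (by positivity) |> abs_le.2
  set T : (Fin k → Fin n) → ℝ := fun α => weakDeriv Ω α v (affineTransform A b x)
  calc tensorPullback A T β ^ 2 ≤ ∑ β, tensorPullback A T β ^ 2 :=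
        Finset.single_le_sum (f := fun β => tensorPullback A T β ^ 2)
          (fun β _ => sq_nonneg _) (Finset.mem_univ β)
    _ ≤ (euclideanMatrixNorm A ^ k) ^ 2 * ∑ α, T α ^ 2 := sum_sq_tensorPullback_le A k T
    _ ≤ (euclideanMatrixNorm A ^ k) ^ 2 * ∑ _α : Fin k → Fin n, S ^ 2 := by
        refine mul_le_mul_of_nonneg_left (Finset.sum_le_sum fun α _ => ?_) (by positivity)
        exact sq_le_sq' (abs_le.1 (hxS α)).1 (abs_le.1 (hxS α)).2
    _ = _ := by
        rw [Finset.sum_const, Finset.card_univ, Fintype.card_fun, Fintype.card_fin,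
          Fintype.card_fin, nsmul_eq_mul, mul_pow, mul_pow, ← Real.sqrt_eq_rpow,
          Real.sq_sqrt (by positivity)]
        ring

theorem sobolevSeminorm_comp_affineTransform_le {n k : ℕ} {p : ℝ≥0∞} (hp : 1 ≤ p)
    {A : Matrix (Fin n) (Fin n) ℝ} (hA : A.det ≠ 0) (b : EucSpace n)
    {s : Set (EucSpace n)} (hs : IsOpen s) {v : EucSpace n → ℝ}
    (hv : MemSobolev k p (affineTransform A b '' s) v) :
    sobolevSeminorm k p s (v ∘ affineTransform A b) ≤
      (n : ℝ) ^ ((k : ℝ) * muExp p) * euclideanMatrixNorm A ^ k * (|A.det|⁻¹ ^ (p⁻¹).toReal *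
        sobolevSeminorm k p (affineTransform A b '' s) v) := by
  rw [Real.rpow_mul (by positivity), Real.rpow_natCast, ← Nat.cast_pow]
  by_cases hp' : p = ⊤
  · subst hp'
    have h := sobolevSeminorm_comp_affineTransform_le_of_top hA b hs hv
    simpa [muExp] using h
  · exact sobolevSeminorm_comp_affineTransform_le_of_ne_top hp hp' hA b hs hv

/-! ### Both estimates -/

/-- For `n = 0` this fails: the empty matrix has determinant `1` and norm `0`. -/
theorem euclideanMatrixNorm_pos {n : ℕ} (hn : 1 ≤ n) {A : Matrix (Fin n) (Fin n) ℝ}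
    (hA : A.det ≠ 0) : 0 < euclideanMatrixNorm A := by
  refine norm_pos_iff.2 fun h => hA ?_
  have h0 : A = 0 := (map_eq_zero_iff _ (Matrix.toEuclideanCLM (𝕜 := ℝ)).injective).1 h
  have : Nonempty (Fin n) := ⟨⟨0, hn⟩⟩
  rw [h0, Matrix.det_zero]

theorem mainTheorem10 (n k : ℕ) (hn : 1 ≤ n) (p : ℝ≥0∞) (hp : 1 ≤ p)
    (A : Matrix (Fin n) (Fin n) ℝ) (hA : A.det ≠ 0) (b : EucSpace n)
    (Ω' Ω : Set (EucSpace n)) (hΩ' : IsOpen Ω') (hΩ : Ω = affineTransform A b '' Ω')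
    (v : EucSpace n → ℝ) (hv : MemSobolev k p Ω v) :
    (p ≠ ⊤ → muExp p = (tauExp p.toReal + gammaExp p.toReal) / p.toReal) ∧
    MemSobolev k p Ω' (v ∘ affineTransform A b) ∧
    (n : ℝ) ^ (-((k : ℝ) * muExp p)) * |A.det| ^ (p⁻¹).toReal *
        (euclideanMatrixNorm A ^ k)⁻¹ * sobolevSeminorm k p Ω' (v ∘ affineTransform A b)
      ≤ sobolevSeminorm k p Ω v ∧
    sobolevSeminorm k p Ω v
      ≤ (n : ℝ) ^ ((k : ℝ) * muExp p) * |A.det| ^ (p⁻¹).toReal *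
        euclideanMatrixNorm A⁻¹ ^ k * sobolevSeminorm k p Ω' (v ∘ affineTransform A b) := by
  subst hΩ
  have hv' := hv.comp_affineTransform hA b hΩ'
  have hn0 : (0 : ℝ) < n := by exact_mod_cast hn
  have hd : 0 < |A.det| := abs_pos.2 hA
  have hN := euclideanMatrixNorm_pos hn hA
  refine ⟨muExp_eq_div hp, hv', ?_, ?_⟩
  · have h := sobolevSeminorm_comp_affineTransform_le hp hA b hΩ' hv
    rw [Real.inv_rpow hd.le] at h
    rw [Real.rpow_neg hn0.le]
    have h1 : 0 < (n : ℝ) ^ ((k : ℝ) * muExp p) := by positivity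
    have h2 : 0 < |A.det| ^ (p⁻¹).toReal := by positivity
    have h3 : 0 < euclideanMatrixNorm A ^ k := by positivity
    calc _ ≤ _ := mul_le_mul_of_nonneg_left h (by positivity)
      _ = _ := by field_simp
  · have hA' : A⁻¹.det ≠ 0 := (Matrix.isUnit_nonsing_inv_det A hA.isUnit).ne_zero
    set e := matrixAffineHomeomorph A hA b
    -- With this translation part, `A⁻¹` gives the affine map `φ⁻¹`, which carries `Ω` back to `Ω'`
    -- and `v ∘ φ` back to `v`.
    set b' : EucSpace n := -Matrix.toEuclideanCLM (𝕜 := ℝ) A⁻¹ b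
    have himg : affineTransform A⁻¹ b' '' (affineTransform A b '' Ω') = Ω' :=
      e.symm_image_image Ω'
    have hcomp : (v ∘ affineTransform A b) ∘ affineTransform A⁻¹ b' = v := by
      ext y
      exact congrArg v (e.apply_symm_apply y)
    have h := sobolevSeminorm_comp_affineTransform_le (k := k) hp hA' b'
      (isOpen_image_affineTransform hA b hΩ') (v := v ∘ affineTransform A b) (by rwa [himg])
    have hdet : |A⁻¹.det|⁻¹ = |A.det| := by
      rw [Matrix.det_nonsing_inv, Ring.inverse_eq_inv', abs_inv, inv_inv]
    rw [himg, hcomp, hdet] at h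
    exact h.trans_eq (by ring)
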